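/- Let $T:\mathbb Z_2\to\mathbb Z_2$ be the $3x+1$ map, $T(x)=x/2$ for even $x$ and $T(x)=(3x+1)/2$ for odd $x$, and let $Q:\mathbb Z_2\to\mathbb Z_2$, $Q(x)=\sum_{j\ge 0}s_j2^j$, where $s_j\in\{0,1\}$ and $s_j\equiv T^j(x)\pmod 2$. For $n\ge 0$, let $Q_n$ be the permutation of $\mathbb Z/2^n\mathbb Z$ induced by $Q$, that is, $Q_n(x)=Q(x)\bmod 2^n$. Let $m\ge k\ge 0$ and let $C=(c_1,\dots,c_{2^k})$ be a cycle of $Q_m$ of length $2^k$ (fixed points count as cycles of length $1$), its elements being identified with integers in $\{0,\dots,2^m-1\}$. Suppose that $C$ has an ever-doubling period, i.e. for every $n\ge m$ the elements $c_1,\dots,c_{2^k}$ (modulo $2^n$) all lie in a single cycle of $Q_n$ of length $2^{n-m+k}$. Let $K=B(c_1,2^{-m})\cup\dots\cup B(c_{2^k},2^{-m})$, where $B(y,r)=\{x\in\mathbb Z_2:|x-y|_2\le r\}$. Then $Q$ maps $K$ into itself, and the restriction of $Q$ to $K$ is ergodic with respect to the restriction to $K$ of the Haar measure on $\mathbb Z_2$: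 it preserves this measure, and every measurable set $A\subseteq K$ with $(Q|_K)^{-1}(A)=A$ is null or has null complement in $K$. -/

import Mathlib

open MeasureTheory

theorem PadicInt.two_dvd_sub_one {x : ℤ_[2]} (h : ¬ (2 : ℤ_[2]) ∣ x) : (2 : ℤ_[2]) ∣ x - 1 := by
  have key : ∀ y : ℤ_[2], PadicInt.toZMod y = 0 ↔ (2 : ℤ_[2]) ∣ y := fun y => by
    rw [← RingHom.mem_ker, PadicInt.ker_toZMod, PadicInt.maximalIdeal_eq_span_p,
      Ideal.mem_span_singleton]
    norm_cast
  rw [← key] at h ⊢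
  rw [map_sub, map_one]
  generalize PadicInt.toZMod x = a at h ⊢
  revert a
  decide

theorem PadicInt.two_dvd_three_mul_add_one {x : ℤ_[2]} (h : ¬ (2 : ℤ_[2]) ∣ x) :
    (2 : ℤ_[2]) ∣ 3 * x + 1 := by
  obtain ⟨y, hy⟩ := PadicInt.two_dvd_sub_one h
  exact ⟨3 * y + 2, by linear_combination 3 * hy⟩

namespace Collatz

open Classical in
/-- The `3x+1` map `T` on the 2-adic integers: `T x = x / 2` for even `x`, and
`T x = (3 * x + 1) / 2` for odd `x`. -/
noncomputable def T (x : ℤ_[2]) : ℤ_[2] :=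
  if h : (2 : ℤ_[2]) ∣ x then h.choose else (PadicInt.two_dvd_three_mul_add_one h).choose

theorem two_mul_T_of_even {x : ℤ_[2]} (h : (2 : ℤ_[2]) ∣ x) : 2 * T x = x := by
  rw [T, dif_pos h]; exact h.choose_spec.symm

theorem two_mul_T_of_odd {x : ℤ_[2]} (h : ¬ (2 : ℤ_[2]) ∣ x) : 2 * T x = 3 * x + 1 := by
  rw [T, dif_neg h]; exact (PadicInt.two_dvd_three_mul_add_one h).choose_spec.symm

open Classical in
/-- The reduction modulo 2 of a 2-adic integer, as the digit `0` or `1`. -/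
noncomputable def parity (x : ℤ_[2]) : ℤ_[2] := if (2 : ℤ_[2]) ∣ x then 0 else 1

/-- `Q x = ∑ s_k 2^k`, where `s_k` is the parity of the `k`-th iterate of `T` at `x`. -/
noncomputable def Q (x : ℤ_[2]) : ℤ_[2] := ∑' k : ℕ, parity (T^[k] x) * 2 ^ k

/-- The series that defines `Q` converges. -/
theorem summable_Q (x : ℤ_[2]) : Summable fun k : ℕ => parity (T^[k] x) * 2 ^ k := by
  refine Summable.of_norm_bounded (g := fun k : ℕ => (1 / 2 : ℝ) ^ k)
    (summable_geometric_of_lt_one (by norm_num) (by norm_num)) fun k => ?_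
  have h2 : ‖(2 : ℤ_[2])‖ = 1 / 2 := by
    have := PadicInt.norm_p (p := 2)
    norm_num at this ⊢
    exact this
  rw [norm_mul, norm_pow, h2]
  exact mul_le_of_le_one_left (by positivity) (PadicInt.norm_le_one _)

theorem Q_eq (x : ℤ_[2]) : Q x = parity x + 2 * Q (T x) := by
  rw [Q, (summable_Q x).tsum_eq_zero_add, Q,
    ← (summable_Q (T x)).tsum_mul_left]
  simp only [Function.iterate_zero, id, pow_zero, mul_one, Function.iterate_succ_apply]
  congr 1
  exact tsum_congr fun k => by ring

theorem two_dvd_sub_parity (x : ℤ_[2]) : (2 : ℤ_[2]) ∣ x - parity x := by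
  unfold parity
  split_ifs with h
  · simpa using h
  · exact PadicInt.two_dvd_sub_one h

theorem parity_eq_iff (x y : ℤ_[2]) : parity x = parity y ↔ (2 : ℤ_[2]) ∣ x - y := by
  constructor
  · intro h
    have := dvd_sub (two_dvd_sub_parity x) (two_dvd_sub_parity y)
    rwa [h, sub_sub_sub_cancel_right] at this
  · intro h
    have : (2 : ℤ_[2]) ∣ x ↔ (2 : ℤ_[2]) ∣ y := (dvd_iff_dvd_of_dvd_sub h)
    unfold parity
    by_cases hx : (2 : ℤ_[2]) ∣ x
    · rw [if_pos hx, if_pos (this.1 hx)]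
    · rw [if_neg hx, if_neg (fun hy => hx (this.2 hy))]

/-- `Q` preserves and reflects congruences modulo `2 ^ n`. -/
theorem two_pow_dvd_Q_sub_iff (n : ℕ) (x y : ℤ_[2]) :
    (2 : ℤ_[2]) ^ n ∣ Q x - Q y ↔ (2 : ℤ_[2]) ^ n ∣ x - y := by
  induction n generalizing x y with
  | zero => simp
  | succ n ih =>
    have h20 : (2 : ℤ_[2]) ≠ 0 := two_ne_zero
    by_cases hp : (2 : ℤ_[2]) ∣ x - y
    · have hpar := (parity_eq_iff x y).2 hp
      have hQ : Q x - Q y = 2 * (Q (T x) - Q (T y)) := by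
        rw [Q_eq x, Q_eq y, hpar]; ring
      rw [hQ, pow_succ', mul_dvd_mul_iff_left h20, ih]
      rw [← mul_dvd_mul_iff_left h20]
      by_cases hx : (2 : ℤ_[2]) ∣ x
      · have hy : (2 : ℤ_[2]) ∣ y := (dvd_iff_dvd_of_dvd_sub hp).1 hx
        rw [mul_sub, two_mul_T_of_even hx, two_mul_T_of_even hy]
      · have hy : ¬ (2 : ℤ_[2]) ∣ y := fun h => hx ((dvd_iff_dvd_of_dvd_sub hp).2 h)
        have e : 2 * (T x - T y) = 3 * (x - y) := by
          rw [mul_sub, two_mul_T_of_odd hx, two_mul_T_of_odd hy]; ring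
        rw [e, ← pow_succ']
        have hco : IsCoprime ((2 : ℤ_[2]) ^ (n + 1)) 3 :=
          IsCoprime.pow_left ⟨-1, 1, by norm_num⟩
        exact ⟨hco.dvd_of_dvd_mul_left, fun h => h.mul_left 3⟩
    · refine ⟨fun h => ?_, fun h => ?_⟩
      · refine absurd ?_ hp
        rw [← parity_eq_iff]
        have h1 : (2 : ℤ_[2]) ∣ Q x - Q y := (dvd_pow_self 2 n.succ_ne_zero).trans h
        have h2 : (2 : ℤ_[2]) ∣ parity x - parity y := by
          have e : parity x - parity y = (Q x - Q y) - 2 * (Q (T x) - Q (T y)) := by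
            rw [Q_eq x, Q_eq y]; ring
          rw [e]
          exact dvd_sub h1 (dvd_mul_right _ _)
        rw [parity_eq_iff]
        have := dvd_sub (dvd_add h2 (two_dvd_sub_parity x)) (two_dvd_sub_parity y)
        have e : x - y = parity x - parity y + (x - parity x) - (y - parity y) := by ring
        rwa [e]
      · exact absurd ((dvd_pow_self 2 n.succ_ne_zero).trans h) hp

theorem toZModPow_eq_iff (n : ℕ) (x y : ℤ_[2]) :
    PadicInt.toZModPow n x = PadicInt.toZModPow n y ↔ (2 : ℤ_[2]) ^ n ∣ x - y := by
  rw [← sub_eq_zero, ← map_sub, ← RingHom.mem_ker, PadicInt.ker_toZModPow,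
    Ideal.mem_span_singleton]
  norm_cast

/-- `x ↦ Q x mod 2 ^ n` on `ℤ / 2 ^ n ℤ`, where a residue class is represented by its
representative in `{0, …, 2 ^ n - 1}`. -/
noncomputable def Qmod (n : ℕ) (x : ZMod (2 ^ n)) : ZMod (2 ^ n) :=
  PadicInt.toZModPow n (Q (x.val : ℤ_[2]))

/-- `Qmod` does not depend on the choice of the representatives. -/
theorem Qmod_toZModPow (n : ℕ) (x : ℤ_[2]) :
    Qmod n (PadicInt.toZModPow n x) = PadicInt.toZModPow n (Q x) := by
  rw [Qmod, toZModPow_eq_iff, two_pow_dvd_Q_sub_iff, ← toZModPow_eq_iff]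
  simp

theorem Qmod_bijective (n : ℕ) : Function.Bijective (Qmod n) := by
  refine Finite.injective_iff_bijective.1 fun x y h => ?_
  rw [Qmod, Qmod, toZModPow_eq_iff, two_pow_dvd_Q_sub_iff, ← toZModPow_eq_iff] at h
  simpa using h

/-- The permutation `Q_n` of `ℤ / 2 ^ n ℤ` induced by `Q`. -/
noncomputable def Qperm (n : ℕ) : Equiv.Perm (ZMod (2 ^ n)) :=
  Equiv.ofBijective (Qmod n) (Qmod_bijective n)

/-- `C` is (the set of elements of) a cycle of length `L` of the permutation `σ`;
fixed points are cycles of length `1`. -/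
def IsCycleOfLength {α : Type*} (σ : Equiv.Perm α) (C : Finset α) (L : ℕ) : Prop :=
  σ.IsCycleOn (C : Set α) ∧ C.card = L

/-- The cycle `C` of `Q_m`, of length `2 ^ k`, has an ever-doubling period: for all `n ≥ m`, its
elements, as integers in `{0, …, 2 ^ m - 1}`, all lie in one cycle of `Q_n`, of length
`2 ^ (n - m + k)`. -/
def EverDoubling (m k : ℕ) (C : Finset (ZMod (2 ^ m))) : Prop :=
  ∀ n : ℕ, m ≤ n → ∃ D : Finset (ZMod (2 ^ n)),
    IsCycleOfLength (Qperm n) D (2 ^ (n - m + k)) ∧ ∀ c ∈ C, (c.val : ZMod (2 ^ n)) ∈ D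

/-- The union of the closed balls `B(c, 2 ^ (-m))`, for `c` in `C`. -/
def ballUnion (m : ℕ) (C : Finset (ZMod (2 ^ m))) : Set ℤ_[2] :=
  ⋃ c ∈ C, Metric.closedBall (c.val : ℤ_[2]) ((2 : ℝ) ^ (-(m : ℤ)))

/-- The 2-adic integers carry their Borel σ-algebra. -/
noncomputable instance instMeasurableSpacePadicInt : MeasurableSpace ℤ_[2] := borel ℤ_[2]

instance instBorelSpacePadicInt : BorelSpace ℤ_[2] := ⟨rfl⟩

/-- The Haar measure on the additive group of the 2-adic integers, of total mass `1`. -/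
noncomputable def haar : Measure ℤ_[2] := Measure.addHaarMeasure ⊤

end Collatz

open Function Set

namespace Collatz

/-! Let `K` be `ballUnion m C`. For `n ≥ m` the cycle of `Q_n` through `C` stays inside the classes
that lie over `C`, and the doubling hypothesis gives it as many elements as there are such classes,
so it consists of all of them (`EverDoubling.exists_isCycleOn`). Hence a finite `Q`-invariant
measure on `K` has equal mass on all classes modulo `2 ^ n` in `K`. These classes form a generating
π-system, so the measure is unique up to scaling (`smul_eq_smul_of_measurePreserving`). For an
invariant `A ⊆ K`, Haar measure restricted to `A` is thus proportional to Haar measure restricted to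
`K`, which forces `A` or `K \ A` to be null. -/

/-! ### Residue classes as a basis and a π-system -/

/-- The residue class of `a` modulo `2 ^ n`, as a subset of the 2-adic integers. -/
def residueClass (n : ℕ) (a : ZMod (2 ^ n)) : Set ℤ_[2] := {x | PadicInt.toZModPow n x = a}

theorem mem_residueClass {n : ℕ} {a : ZMod (2 ^ n)} {x : ℤ_[2]} :
    x ∈ residueClass n a ↔ PadicInt.toZModPow n x = a := Iff.rfl

theorem toZModPow_val (n : ℕ) (a : ZMod (2 ^ n)) :
    PadicInt.toZModPow n ((a.val : ℕ) : ℤ_[2]) = a := by simp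

theorem toZModPow_eq_of_le {m n : ℕ} (h : m ≤ n) {x y : ℤ_[2]}
    (e : PadicInt.toZModPow n x = PadicInt.toZModPow n y) :
    PadicInt.toZModPow m x = PadicInt.toZModPow m y := by
  rw [toZModPow_eq_iff] at e ⊢
  exact (pow_dvd_pow 2 h).trans e

theorem mem_closedBall_iff_toZModPow_eq (n : ℕ) (x y : ℤ_[2]) :
    x ∈ Metric.closedBall y ((2 : ℝ) ^ (-(n : ℤ))) ↔
      PadicInt.toZModPow n x = PadicInt.toZModPow n y := by
  have h := PadicInt.norm_le_pow_iff_mem_span_pow (p := 2) (x - y) n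
  rw [Ideal.mem_span_singleton] at h
  rw [Metric.mem_closedBall, dist_eq_norm, toZModPow_eq_iff]
  exact_mod_cast h

theorem residueClass_toZModPow (n : ℕ) (x : ℤ_[2]) :
    residueClass n (PadicInt.toZModPow n x) = Metric.closedBall x ((2 : ℝ) ^ (-(n : ℤ))) :=
  Set.ext fun _ => (mem_closedBall_iff_toZModPow_eq n _ _).symm

theorem isOpen_residueClass (n : ℕ) (a : ZMod (2 ^ n)) : IsOpen (residueClass n a) := by
  rw [← toZModPow_val n a, residueClass_toZModPow]
  exact IsUltrametricDist.isOpen_closedBall _ (by positivity)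

theorem mem_ballUnion {m : ℕ} {C : Finset (ZMod (2 ^ m))} {x : ℤ_[2]} :
    x ∈ ballUnion m C ↔ PadicInt.toZModPow m x ∈ C := by
  simp only [ballUnion, mem_iUnion, mem_closedBall_iff_toZModPow_eq, toZModPow_val, exists_prop]
  exact ⟨fun ⟨c, hc, h⟩ => h ▸ hc, fun h => ⟨_, h, rfl⟩⟩

/-- The residue classes modulo `2 ^ n`, for all `n ≥ m`, together with the empty set. -/
def residueClasses (m : ℕ) : Set (Set ℤ_[2]) :=
  {s | s = ∅ ∨ ∃ n, m ≤ n ∧ ∃ a : ZMod (2 ^ n), s = residueClass n a}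

theorem isTopologicalBasis_residueClasses (m : ℕ) :
    TopologicalSpace.IsTopologicalBasis (residueClasses m) := by
  refine TopologicalSpace.isTopologicalBasis_of_isOpen_of_nhds ?_ fun x u hx hu => ?_
  · rintro _ (rfl | ⟨n, -, a, rfl⟩)
    · exact isOpen_empty
    · exact isOpen_residueClass n a
  · obtain ⟨ε, hε, hb⟩ := Metric.isOpen_iff.1 hu x hx
    obtain ⟨n, hn⟩ := exists_pow_lt_of_lt_one hε (by norm_num : (1 / 2 : ℝ) < 1)
    refine ⟨_, Or.inr ⟨max m n, le_max_left _ _, PadicInt.toZModPow _ x, rfl⟩, rfl, ?_⟩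
    rw [residueClass_toZModPow]
    refine (Metric.closedBall_subset_ball (lt_of_le_of_lt ?_ hn)).trans hb
    rw [zpow_neg, zpow_natCast, one_div, inv_pow]
    gcongr
    · norm_num
    · exact le_max_right _ _

theorem isPiSystem_residueClasses (m : ℕ) : IsPiSystem (residueClasses m) := by
  have key : ∀ n₁ n₂, m ≤ n₁ → n₁ ≤ n₂ → ∀ (a : ZMod (2 ^ n₁)) (b : ZMod (2 ^ n₂)),
      residueClass n₁ a ∩ residueClass n₂ b ∈ residueClasses m := by
    intro n₁ n₂ h₁ h₂ a b
    rcases eq_empty_or_nonempty (residueClass n₁ a ∩ residueClass n₂ b) with h | ⟨x, hxa, hxb⟩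
    · exact Or.inl h
    -- Two classes that meet are nested: the finer one is the intersection.
    · refine Or.inr ⟨n₂, h₁.trans h₂, b, inter_eq_right.2 fun y hy => ?_⟩
      rw [mem_residueClass] at *
      rw [← hxa]
      exact toZModPow_eq_of_le h₂ (hy.trans hxb.symm)
  rintro _ (rfl | ⟨n₁, h₁, a, rfl⟩) _ (rfl | ⟨n₂, h₂, b, rfl⟩) -
  · simp [residueClasses]
  · simp [residueClasses]
  · simp [residueClasses]
  · rcases le_total n₁ n₂ with h | h
    · exact key n₁ n₂ h₁ h a b
    · rw [inter_comm]; exact key n₂ n₁ h₂ h b a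

theorem ext_of_residueClass (m : ℕ) {μ ν : Measure ℤ_[2]} [IsFiniteMeasure μ]
    (huniv : μ univ = ν univ)
    (h : ∀ n, m ≤ n → ∀ a : ZMod (2 ^ n), μ (residueClass n a) = ν (residueClass n a)) :
    μ = ν := by
  refine ext_of_generate_finite (residueClasses m) ?_ (isPiSystem_residueClasses m) ?_ huniv
  · rw [← (isTopologicalBasis_residueClasses m).borel_eq_generateFrom]
    exact BorelSpace.measurable_eq
  · rintro _ (rfl | ⟨n, hn, a, rfl⟩)
    · simp
    · exact h n hn a

/-! ### Invariance of Haar measure under `Q` -/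

instance : haar.IsAddHaarMeasure := by unfold haar; infer_instance

theorem haar_residueClass_eq (n : ℕ) (a b : ZMod (2 ^ n)) :
    haar (residueClass n a) = haar (residueClass n b) := by
  have : residueClass n a = (fun x => ((b.val : ℤ_[2]) - (a.val : ℤ_[2])) + x) ⁻¹'
      residueClass n b := by
    ext x
    simp only [mem_preimage, mem_residueClass, map_add, map_sub, toZModPow_val]
    rw [sub_add_eq_add_sub, add_sub_assoc, add_eq_left, sub_eq_zero]
  rw [this, measure_preimage_add]

theorem preimage_Q_residueClass (n : ℕ) (a : ZMod (2 ^ n)) :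
    Q ⁻¹' residueClass n (Qperm n a) = residueClass n a := by
  ext x
  rw [mem_preimage, mem_residueClass, mem_residueClass, ← Qmod_toZModPow]
  exact (Qperm n).injective.eq_iff

theorem continuous_Q : Continuous Q := by
  refine (isTopologicalBasis_residueClasses 0).continuous_iff.2 ?_
  rintro _ (rfl | ⟨n, -, a, rfl⟩)
  · exact isOpen_empty
  · obtain ⟨b, rfl⟩ := (Qperm n).surjective a
    rw [preimage_Q_residueClass]
    exact isOpen_residueClass n b

/-- At each level `Q` permutes classes of equal Haar measure. -/
theorem measurePreserving_Q : MeasurePreserving Q haar haar := by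
  have hQ := continuous_Q.measurable
  refine ⟨hQ, ?_⟩
  have : IsFiniteMeasure (haar.map Q) := Measure.isFiniteMeasure_map _ _
  refine ext_of_residueClass 0 (by rw [Measure.map_apply hQ .univ, preimage_univ]) ?_
  intro n _ a
  obtain ⟨b, rfl⟩ := (Qperm n).surjective a
  rw [Measure.map_apply hQ (isOpen_residueClass _ _).measurableSet, preimage_Q_residueClass]
  exact haar_residueClass_eq n _ _

theorem preimage_Q_ballUnion {m : ℕ} {C : Finset (ZMod (2 ^ m))}
    (hC : (Qperm m).IsCycleOn (C : Set (ZMod (2 ^ m)))) :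
    Q ⁻¹' ballUnion m C = ballUnion m C := by
  ext x
  rw [mem_preimage, mem_ballUnion, mem_ballUnion, ← Qmod_toZModPow]
  exact hC.apply_mem_iff

/-! ### Lifting the cycle to level `n` -/

theorem card_filter_natCast_mem_le {m n : ℕ} (hmn : m ≤ n) (C : Finset (ZMod (2 ^ m))) :
    (Finset.univ.filter fun a : ZMod (2 ^ n) => ((a.val : ℕ) : ZMod (2 ^ m)) ∈ C).card ≤
      C.card * 2 ^ (n - m) := by
  rw [← Finset.card_range (2 ^ (n - m)), ← Finset.card_product]
  -- Remainder and quotient by `2 ^ m` determine `a`.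
  refine Finset.card_le_card_of_injOn
    (fun a => (((a.val : ℕ) : ZMod (2 ^ m)), a.val / 2 ^ m)) ?_ ?_
  · intro a ha
    simp only [Finset.coe_filter, Finset.mem_univ, true_and, mem_ofPred_eq] at ha
    simp only [Finset.coe_product, mem_prod, Finset.mem_coe, Finset.mem_range]
    refine ⟨ha, Nat.div_lt_of_lt_mul ?_⟩
    rw [← pow_add, Nat.add_sub_cancel' hmn]
    exact a.val_lt
  · intro a _ b _ h
    obtain ⟨h₁, h₂⟩ := Prod.mk.inj h
    have h₃ : a.val % 2 ^ m = b.val % 2 ^ m := (ZMod.natCast_eq_natCast_iff _ _ _).1 h₁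
    apply ZMod.val_injective
    rw [← Nat.div_add_mod a.val (2 ^ m), ← Nat.div_add_mod b.val (2 ^ m), h₂, h₃]

/-- A cycle with an ever-doubling period lifts to a single cycle modulo `2 ^ n`, which consists of
all the residue classes in `ballUnion m C`. -/
theorem EverDoubling.exists_isCycleOn {m k : ℕ} {C : Finset (ZMod (2 ^ m))}
    (hC : IsCycleOfLength (Qperm m) C (2 ^ k)) (h : EverDoubling m k C) {n : ℕ} (hmn : m ≤ n) :
    ∃ D : Finset (ZMod (2 ^ n)), (Qperm n).IsCycleOn (D : Set (ZMod (2 ^ n))) ∧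
      ∀ x : ℤ_[2], PadicInt.toZModPow n x ∈ D ↔ x ∈ ballUnion m C := by
  obtain ⟨D, ⟨hD, hDcard⟩, hCD⟩ := h n hmn
  refine ⟨D, hD, ?_⟩
  obtain ⟨c, hc⟩ : C.Nonempty := Finset.card_pos.1 (hC.2 ▸ by positivity)
  have hmem : ∀ i : ℕ, Q^[i] (c.val : ℤ_[2]) ∈ ballUnion m C := by
    intro i
    induction i with
    | zero => rw [mem_ballUnion, iterate_zero, id, toZModPow_val]; exact hc
    | succ i ih =>
      rw [iterate_succ_apply']
      rwa [← preimage_Q_ballUnion hC.1] at ih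
  have hpow : ∀ i : ℕ, ((Qperm n) ^ i) (PadicInt.toZModPow n (c.val : ℤ_[2])) =
      PadicInt.toZModPow n (Q^[i] (c.val : ℤ_[2])) := by
    intro i
    induction i with
    | zero => rfl
    | succ i ih =>
      rw [pow_succ', Equiv.Perm.mul_apply, ih, iterate_succ_apply']
      exact Qmod_toZModPow n _
  have hsub : ∀ x : ℤ_[2], PadicInt.toZModPow n x ∈ D → x ∈ ballUnion m C := by
    intro x hx
    have hcD : PadicInt.toZModPow n (c.val : ℤ_[2]) ∈ D := by
      rw [map_natCast]; exact hCD c hc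
    obtain ⟨i, -, hi⟩ := hD.exists_pow_eq hcD hx
    rw [hpow] at hi
    have := hmem i
    rw [mem_ballUnion] at this ⊢
    rwa [← toZModPow_eq_of_le hmn hi]
  have hDeq : D = Finset.univ.filter
      fun a : ZMod (2 ^ n) => ((a.val : ℕ) : ZMod (2 ^ m)) ∈ C := by
    -- One inclusion holds because the orbit of `c` never leaves `K`; equality follows by counting,
    -- as `2 ^ k * 2 ^ (n - m) = 2 ^ (n - m + k)`.
    refine Finset.eq_of_subset_of_card_le (fun a ha => ?_) ?_
    · rw [Finset.mem_filter]
      refine ⟨Finset.mem_univ _, ?_⟩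
      have := hsub (a.val : ℤ_[2]) (by rwa [toZModPow_val])
      rwa [mem_ballUnion, map_natCast] at this
    · refine (card_filter_natCast_mem_le hmn C).trans_eq ?_
      rw [hDcard, hC.2, mul_comm, ← pow_add]
  refine fun x => ⟨hsub x, fun hx => ?_⟩
  rw [hDeq, Finset.mem_filter, ← map_natCast (PadicInt.toZModPow m),
    toZModPow_eq_of_le hmn (toZModPow_val n (PadicInt.toZModPow n x))]
  exact ⟨Finset.mem_univ _, mem_ballUnion.1 hx⟩

/-! ### Uniqueness of the invariant measure -/

/-- A measure that is invariant under `Q` takes the same value on all residue classes in a cycle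
of `Q_n`. -/
theorem measure_residueClass_eq_of_isCycleOn {ν : Measure ℤ_[2]} (hν : MeasurePreserving Q ν ν)
    {n : ℕ} {D : Finset (ZMod (2 ^ n))} (hD : (Qperm n).IsCycleOn (D : Set (ZMod (2 ^ n))))
    {a b : ZMod (2 ^ n)} (ha : a ∈ D) (hb : b ∈ D) :
    ν (residueClass n a) = ν (residueClass n b) := by
  obtain ⟨i, -, rfl⟩ := hD.exists_pow_eq ha hb
  clear hb
  induction i with
  | zero => rfl
  | succ i ih =>
    rw [pow_succ', Equiv.Perm.mul_apply, ih, ← preimage_Q_residueClass n ((Qperm n ^ i) a)]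
    exact hν.measure_preimage (isOpen_residueClass _ _).measurableSet.nullMeasurableSet

theorem ballUnion_eq_biUnion_residueClass {m n : ℕ} {C : Finset (ZMod (2 ^ m))}
    {D : Finset (ZMod (2 ^ n))}
    (hDC : ∀ x : ℤ_[2], PadicInt.toZModPow n x ∈ D ↔ x ∈ ballUnion m C) :
    ballUnion m C = ⋃ a ∈ D, residueClass n a := by
  ext x
  simp [← hDC, mem_residueClass]

theorem measurableSet_ballUnion (m : ℕ) (C : Finset (ZMod (2 ^ m))) :
    MeasurableSet (ballUnion m C) :=
  Finset.measurableSet_biUnion _ fun _ _ => Metric.isClosed_closedBall.measurableSet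

theorem measure_ballUnion {ν : Measure ℤ_[2]} (hν : MeasurePreserving Q ν ν)
    {m n : ℕ} {C : Finset (ZMod (2 ^ m))}
    {D : Finset (ZMod (2 ^ n))} (hD : (Qperm n).IsCycleOn (D : Set (ZMod (2 ^ n))))
    (hDC : ∀ x : ℤ_[2], PadicInt.toZModPow n x ∈ D ↔ x ∈ ballUnion m C)
    {a : ZMod (2 ^ n)} (ha : a ∈ D) :
    ν (ballUnion m C) = D.card * ν (residueClass n a) := by
  rw [ballUnion_eq_biUnion_residueClass hDC, measure_biUnion_finset,
    Finset.sum_congr rfl fun b hb => measure_residueClass_eq_of_isCycleOn hν hD hb ha,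
    Finset.sum_const, nsmul_eq_mul]
  · intro b _ c _ hbc
    exact Set.disjoint_left.2 fun x hxb hxc => hbc (hxb.symm.trans hxc)
  · exact fun b _ => (isOpen_residueClass n b).measurableSet

/-- If all elements of `C` lie on one cycle modulo each `2 ^ n`, then up to scaling there is only
one finite measure on `ballUnion m C` that is invariant under `Q`. -/
theorem smul_eq_smul_of_measurePreserving {m k : ℕ} {C : Finset (ZMod (2 ^ m))}
    (hC : IsCycleOfLength (Qperm m) C (2 ^ k)) (h : EverDoubling m k C)
    {μ ν : Measure ℤ_[2]} [IsFiniteMeasure μ] [IsFiniteMeasure ν]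
    (hμ : MeasurePreserving Q μ μ) (hν : MeasurePreserving Q ν ν)
    (hμC : μ (ballUnion m C)ᶜ = 0) (hνC : ν (ballUnion m C)ᶜ = 0) :
    ν (ballUnion m C) • μ = μ (ballUnion m C) • ν := by
  have hK := measurableSet_ballUnion m C
  have : IsFiniteMeasure (ν (ballUnion m C) • μ) :=
    Measure.smul_finite μ (measure_ne_top ν _)
  refine ext_of_residueClass m ?_ fun n hmn a => ?_
  · have eμ : μ univ = μ (ballUnion m C) := by rw [← measure_add_measure_compl hK, hμC, add_zero]
    have eν : ν univ = ν (ballUnion m C) := by rw [← measure_add_measure_compl hK, hνC, add_zero]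
    simp only [Measure.smul_apply, smul_eq_mul, eμ, eν]
    exact mul_comm _ _
  · obtain ⟨D, hD, hDC⟩ := h.exists_isCycleOn hC hmn
    simp only [Measure.smul_apply, smul_eq_mul]
    by_cases ha : a ∈ D
    · rw [measure_ballUnion hν hD hDC ha, measure_ballUnion hμ hD hDC ha]
      ring
    -- A class outside the cycle misses `K`, so both measures vanish on it.
    · have hsub : residueClass n a ⊆ (ballUnion m C)ᶜ := by
        intro x hx hxC
        exact ha (mem_residueClass.1 hx ▸ (hDC x).2 hxC)
      rw [measure_mono_null hsub hμC, measure_mono_null hsub hνC, mul_zero, mul_zero]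

theorem measurePreserving_restrict_of_preimage_eq {A : Set ℤ_[2]} (hA : MeasurableSet A)
    (h : Q ⁻¹' A = A) : MeasurePreserving Q (haar.restrict A) (haar.restrict A) := by
  have := measurePreserving_Q.restrict_preimage hA
  rwa [h] at this

/-! ### Ergodicity -/

theorem haar_eq_zero_or_of_preimage_eq {m k : ℕ} {C : Finset (ZMod (2 ^ m))}
    (hC : IsCycleOfLength (Qperm m) C (2 ^ k)) (h : EverDoubling m k C)
    {A : Set ℤ_[2]} (hA : MeasurableSet A) (hAC : A ⊆ ballUnion m C) (hQA : Q ⁻¹' A = A) :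
    haar A = 0 ∨ haar (ballUnion m C \ A) = 0 := by
  have hK := measurableSet_ballUnion m C
  have key := smul_eq_smul_of_measurePreserving hC h
    (measurePreserving_restrict_of_preimage_eq hK (preimage_Q_ballUnion hC.1))
    (measurePreserving_restrict_of_preimage_eq hA hQA)
    (by rw [Measure.restrict_apply hK.compl, compl_inter_self, measure_empty])
    (by
      rw [Measure.restrict_apply hK.compl]
      exact measure_mono_null (fun x hx => (hx.1 (hAC hx.2)).elim) measure_empty)
  -- On `K \ A` the measure restricted to `A` vanishes, which leaves `haar A * haar (K \ A) = 0`.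
  have key' := congrArg (fun μ : Measure ℤ_[2] => μ (ballUnion m C \ A)) key
  simp only [Measure.smul_apply, smul_eq_mul, Measure.restrict_apply hK,
    Measure.restrict_apply (hK.diff hA), sdiff_inter_self, measure_empty, mul_zero,
    inter_eq_right.2 hAC, inter_eq_left.2 (sdiff_subset : ballUnion m C \ A ⊆ _)] at key'
  exact mul_eq_zero.1 key'

end Collatz

theorem mainTheorem5 (m k : ℕ) (hkm : k ≤ m) (C : Finset (ZMod (2 ^ m)))
    (hC : Collatz.IsCycleOfLength (Collatz.Qperm m) C (2 ^ k))
    (hdouble : Collatz.EverDoubling m k C) :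
    ∃ hK : Set.MapsTo Collatz.Q (Collatz.ballUnion m C) (Collatz.ballUnion m C),
      Ergodic (hK.restrict Collatz.Q (Collatz.ballUnion m C) (Collatz.ballUnion m C))
        (Measure.comap Subtype.val Collatz.haar) := by
  have hpre := Collatz.preimage_Q_ballUnion hC.1
  have hmeas := Collatz.measurableSet_ballUnion m C
  have hemb := MeasurableEmbedding.subtype_coe hmeas
  have hK : Set.MapsTo Collatz.Q (Collatz.ballUnion m C) (Collatz.ballUnion m C) :=
    hpre.symm.subset
  -- Transfers preimages from the subtype to `ℤ_[2]`; this needs `Q ⁻¹' K = K`, not just `K ⊆ Q ⁻¹'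
  -- K`.
  have himage : ∀ s : Set (Collatz.ballUnion m C),
      Subtype.val '' (hK.restrict Collatz.Q _ _ ⁻¹' s) =
        Collatz.Q ⁻¹' (Subtype.val '' s) := by
    intro s
    ext x
    constructor
    · rintro ⟨y, hy, rfl⟩
      exact ⟨_, hy, rfl⟩
    · rintro ⟨y, hy, hyx⟩
      have hx : x ∈ Collatz.ballUnion m C := by
        rw [← hpre, Set.mem_preimage, ← hyx]
        exact y.2
      refine ⟨⟨x, hx⟩, ?_, rfl⟩
      have e : hK.restrict Collatz.Q _ _ ⟨x, hx⟩ = y := Subtype.ext hyx.symm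
      rwa [Set.mem_preimage, e]
  have hQ : Measurable (hK.restrict Collatz.Q _ _) :=
    (Collatz.continuous_Q.measurable.comp measurable_subtype_coe).subtype_mk
  refine ⟨hK, ⟨⟨hQ, ?_⟩, ⟨fun {s} hs hsQ => ?_⟩⟩⟩
  · ext s hs
    rw [Measure.map_apply hQ hs, hemb.comap_apply, hemb.comap_apply, himage]
    exact Collatz.measurePreserving_Q.measure_preimage
      (hemb.measurableSet_image.2 hs).nullMeasurableSet
  · rw [Filter.eventuallyConst_set']
    have hQA := himage s
    rw [hsQ] at hQA
    rcases Collatz.haar_eq_zero_or_of_preimage_eq hC hdouble (hemb.measurableSet_image.2 hs)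
      (Subtype.coe_image_subset _ s) hQA.symm with h | h
    · left
      rwa [ae_eq_empty, hemb.comap_apply]
    · right
      rwa [ae_eq_univ, hemb.comap_apply, Set.image_compl_eq_range_sdiff_image
        Subtype.val_injective, Subtype.range_coe]
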